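/- For an integer $n\ge 0$ let $a_{2,5}(n)$ denote the number of partitions of $n$ into distinct parts none of which is divisible by $2$ or by $5$ (so $a_{2,5}(0)=1$), and for $k\ge 1$ let $f_k=\prod_{m\ge 1}(1-q^{km})\in\mathbb{Z}[[q]]$. A congruence modulo $2$ between two power series with integer coefficients means that their coefficients are congruent modulo $2$ term by term. Let $p>5$ be a prime with Legendre symbol $\left(\frac{-10}{p}\right)=-1$. Then for all integers $\gamma\ge 0$, $$\sum_{n\ge 0} a_{2,5}\Big(4p^{2\gamma}n+\frac{7p^{2\gamma}-1}{6}\Big)q^n\equiv f_2f_5 \pmod 2,$$ $$\sum_{n\ge 0} a_{2,5}\Big(20p^{2\gamma}n+\frac{55p^{2\gamma}-1}{6}\Big)q^n\equiv f_1f_{10} \pmod 2,$$ and, for all integers $n\ge 0$ and all $1\le j\le p-1$, $$a_{2,5}\Big(4p^{2\gamma+1}(pn+j)+\frac{7p^{2\gamma+2}-1}{6}\Big)\equiv 0 \pmod 2,$$ $$a_{2,5}\Big(20p^{2\gamma+1}(pn+j)+\frac{55p^{2\gamma+2}-1}{6}\Big)\equiv 0 \pmod 2.$$ -/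

import Mathlib

namespace RegularPartitions

open PowerSeries
open scoped PowerSeries.WithPiTopology

/-- `a r s n` is the number of partitions of `n` into distinct parts, none of which is divisible
by `r` or by `s`. -/
def a (r s n : ℕ) : ℕ :=
  (Finset.univ.filter fun π : n.Partition =>
    π.parts.Nodup ∧ ∀ i ∈ π.parts, ¬ r ∣ i ∧ ¬ s ∣ i).card

/-- `f k = (q^k; q^k)_∞ = ∏_{m ≥ 0} (1 - q^k (q^k)^m)` as a formal power series over `ℤ`,
the infinite product being taken coefficientwise. -/
noncomputable def f (k : ℕ) : PowerSeries ℤ :=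
  ∏' m : ℕ, (1 - X ^ (k * (m + 1)))

/-- The infinite product defining `f k` converges for `k ≥ 1`. -/
theorem multipliable_f (k : ℕ) (hk : 1 ≤ k) :
    Multipliable fun m : ℕ => (1 - X ^ (k * (m + 1)) : PowerSeries ℤ) := by
  simp_rw [sub_eq_add_neg]
  apply PowerSeries.WithPiTopology.multipliable_one_add_of_tendsto_order_atTop_nhds_top
  simp only [order_neg, order_X_pow]
  refine ENat.tendsto_nhds_top_iff_natCast_lt.mpr fun n => Filter.eventually_atTop.mpr ⟨n, ?_⟩
  intro m hm
  exact_mod_cast (show n < k * (m + 1) by nlinarith)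

/-- Congruence of integral power series modulo `M`: all coefficients are congruent. -/
def SeriesModEq (M : ℤ) (A B : PowerSeries ℤ) : Prop :=
  ∀ n : ℕ, coeff n A ≡ coeff n B [ZMOD M]

end RegularPartitions

/-!
All congruences are modulo `2`. The generating function `A` of `a 2 5` satisfies `A * f 1 ≡ f 5`.
By the pentagonal number theorem the coefficient of `q ^ N` in `f a * f b` has the parity of the
number of solutions of `a * u ^ 2 + b * v ^ 2 = 24 * N + a + b` with `u ≡ v ≡ 1` modulo `6`. For
`f 1 * f 2` and `f 1 * f 5` these are elements of given norm in `ℤ[√(-2)]` and `ℤ[√(-5)]`; pairing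
conjugates and descending at the primes above `3` leaves only squares, which gives
`f 1 ^ 3 ≡ ∑ q ^ (n * (n + 1) / 2)` and `f 1 * f 5 ≡ f 1 ^ 6 + q * f 5 ^ 6`. Splitting `A` twice
into even and odd parts by means of the latter yields `∑ a 2 5 (4 * n + 1) * q ^ n ≡ f 2 * f 5`, so
for `m ≡ 1` modulo `4` the parity of `a 2 5 m` is that of the number of representations
`2 * u ^ 2 + 5 * v ^ 2 = 6 * m + 1`. As `-10` is not a square modulo `p`, this form is anisotropic
modulo `p`: scaling by `±p` is a bijection between the representations of `K` and of `p ^ 2 * K`,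
and a number exactly divisible by an odd power of `p` is not represented.
-/

namespace RegularPartitions

open Set PowerSeries
open scoped PowerSeries.WithPiTopology

section Squares

/-- The coefficients modulo `2` of the partial theta series `∑ q ^ (c * x ^ 2)` over `x ≥ 0`. -/
noncomputable def squareIndicator (c M : ℤ) : ZMod 2 :=
  open Classical in if ∃ x : ℤ, c * x ^ 2 = M then 1 else 0

theorem squareIndicator_eq_zero {c M : ℤ} (h : ∀ x : ℤ, c * x ^ 2 ≠ M) :
    squareIndicator c M = 0 :=
  if_neg fun ⟨x, hx⟩ => h x hx

theorem squareIndicator_congr {c M c' M' : ℤ}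
    (h : (∃ x : ℤ, c * x ^ 2 = M) ↔ ∃ x : ℤ, c' * x ^ 2 = M') :
    squareIndicator c M = squareIndicator c' M' := by
  classical exact if_congr h rfl rfl

theorem three_dvd_of_dvd_mul_sq {c x : ℤ} (hc : ¬ 3 ∣ c) (h : 3 ∣ c * x ^ 2) : 3 ∣ x :=
  Int.prime_three.dvd_of_dvd_pow ((Int.prime_three.dvd_or_dvd h).resolve_left hc)

theorem squareIndicator_three_mul {c M : ℤ} (hc : ¬ 3 ∣ c) (hM : ¬ 3 ∣ M) :
    squareIndicator c (3 * M) = 0 := by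
  refine squareIndicator_eq_zero fun x hx => ?_
  obtain ⟨k, rfl⟩ := three_dvd_of_dvd_mul_sq hc ⟨M, hx⟩
  exact hM ⟨c * k ^ 2, by linarith⟩

theorem squareIndicator_nine_mul {c : ℤ} (hc : ¬ 3 ∣ c) (M : ℤ) :
    squareIndicator c (9 * M) = squareIndicator c M := by
  refine squareIndicator_congr ⟨?_, ?_⟩
  · rintro ⟨x, hx⟩
    obtain ⟨k, rfl⟩ : 3 ∣ x := three_dvd_of_dvd_mul_sq hc ⟨3 * M, by linarith⟩
    exact ⟨k, by linarith⟩
  · rintro ⟨x, rfl⟩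
    exact ⟨3 * x, by ring⟩

theorem sq_emod_three (x : ℤ) : x % 3 = 0 ∧ x ^ 2 % 3 = 0 ∨ x % 3 ≠ 0 ∧ x ^ 2 % 3 = 1 := by
  have h : x % 3 = 0 ∨ x % 3 = 1 ∨ x % 3 = 2 := by omega
  rcases h with h | h | h <;> simp [h, pow_two, Int.mul_emod]

theorem sq_emod_eight (x : ℤ) : x % 2 = 0 ∧ x ^ 2 % 4 = 0 ∨ x % 2 = 1 ∧ x ^ 2 % 8 = 1 := by
  rcases Int.even_or_odd x with h | h
  · obtain ⟨k, rfl⟩ := h.two_dvd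
    exact Or.inl ⟨by omega, by ring_nf; omega⟩
  · have := Int.eight_dvd_sq_sub_one_of_odd h
    exact Or.inr ⟨Int.odd_iff.mp h, by omega⟩

theorem ncard_sq_emod_three {c M : ℤ} (hc : c ≠ 0) (hM : ¬ 3 ∣ M) :
    ({x : ℤ | c * x ^ 2 = M ∧ x % 3 = 1}.ncard : ZMod 2) = squareIndicator c M := by
  by_cases h : ∃ x : ℤ, c * x ^ 2 = M
  · rw [squareIndicator, if_pos h]
    obtain ⟨x, hx⟩ : ∃ x : ℤ, c * x ^ 2 = M ∧ x % 3 = 1 := by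
      obtain ⟨x, hx⟩ := h
      have hx3 : ¬ 3 ∣ x := fun hdvd => hM (hx ▸ (hdvd.pow two_ne_zero).mul_left c)
      rcases (show x % 3 = 1 ∨ -x % 3 = 1 by omega) with h1 | h1
      · exact ⟨x, hx, h1⟩
      · exact ⟨-x, by rw [neg_sq, hx], h1⟩
    rw [ncard_eq_one.mpr ⟨x, ?_⟩, Nat.cast_one]
    ext y
    refine ⟨fun hy => ?_, fun hy => hy ▸ hx⟩
    have hsq : y ^ 2 = x ^ 2 := mul_left_cancel₀ hc (hy.1.trans hx.1.symm)
    rcases sq_eq_sq_iff_eq_or_eq_neg.mp hsq with rfl | rfl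
    · rfl
    · have := hx.2
      have := hy.2
      omega
  · have hempty : {x : ℤ | c * x ^ 2 = M ∧ x % 3 = 1} = ∅ :=
      eq_empty_of_forall_notMem fun x hx => h ⟨x, hx.1⟩
    rw [squareIndicator, if_neg h, hempty, ncard_empty, Nat.cast_zero]

end Squares

theorem ncard_eq_ncard_fixedPoints {α : Type*} {s : Set α} (hs : s.Finite) {σ : α → α}
    (hσ : MapsTo σ s s) (hσσ : ∀ a ∈ s, σ (σ a) = a) :
    (s.ncard : ZMod 2) = {a ∈ s | σ a = a}.ncard := by
  classical
  have := hs.fintype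
  let τ : Function.End s := hσ.restrict
  have hτ : τ ^ 2 ^ 1 = 1 := by
    funext a
    exact Subtype.ext (hσσ a a.2)
  have hfix : {a ∈ s | σ a = a} = Subtype.val '' Function.fixedPoints τ := by
    ext a
    simp [τ, Function.IsFixedPt, Subtype.ext_iff, and_comm]
  rw [hfix, ncard_image_of_injective _ Subtype.val_injective, ← Nat.card_coe_set_eq,
    ← Nat.card_coe_set_eq, Nat.card_eq_fintype_card, Nat.card_eq_fintype_card,
    ZMod.natCast_eq_natCast_iff]
  exact Equiv.Perm.card_fixedPoints_modEq hτ

section Reps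

/-- Representations of `M` by `x ^ 2 + d * y ^ 2`, normalised by `x + y ≡ 1` modulo `3`. When
`d ≡ 2` modulo `3`, `x + y * √(-d) ↦ x + y` is a ring homomorphism from `ℤ[√(-d)]` to `𝔽₃`, so
these are, up to sign, the elements of norm `M` outside one of the primes above `3`. -/
def reps (d M : ℤ) : Set (ℤ × ℤ) :=
  {z | z.1 ^ 2 + d * z.2 ^ 2 = M ∧ (z.1 + z.2) % 3 = 1}

theorem reps_finite {d : ℤ} (hd : 0 < d) (M : ℤ) : (reps d M).Finite := by
  refine ((finite_Icc (-M) M).prod (finite_Icc (-M) M)).subset ?_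
  rintro ⟨x, y⟩ ⟨h, -⟩
  have abs_le_sq (t : ℤ) : |t| ≤ t ^ 2 := by
    rw [← sq_abs]
    exact Int.le_self_sq |t|
  have hx : |x| ≤ M := by nlinarith [abs_le_sq x, sq_nonneg y]
  have hy : |y| ≤ M := by nlinarith [abs_le_sq y, sq_nonneg x, sq_nonneg y]
  exact ⟨abs_le.mp hx, abs_le.mp hy⟩

/-- The one of `±` the conjugate of `x + y * √(-d)` that is `≡ 1` under `x + y * √(-d) ↦ x + y`;
an involution of `reps d M` when `3 ∤ M`. -/
def signedConj (z : ℤ × ℤ) : ℤ × ℤ :=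
  if (z.1 - z.2) % 3 = 1 then (z.1, -z.2) else (-z.1, z.2)

theorem sub_emod_three_ne_zero {d M x y : ℤ} (hd : d % 3 = 2) (hM : ¬ 3 ∣ M)
    (h : x ^ 2 + d * y ^ 2 = M) : (x - y) % 3 ≠ 0 := by
  intro hxy
  obtain ⟨k, hk⟩ := Int.dvd_of_emod_eq_zero hxy
  obtain ⟨e, rfl⟩ : ∃ e, d = 3 * e + 2 := ⟨d / 3, by omega⟩
  obtain rfl : x = y + 3 * k := by omega
  exact hM ⟨3 * k ^ 2 + 2 * k * y + (e + 1) * y ^ 2, by rw [← h]; ring⟩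

theorem mapsTo_signedConj {d M : ℤ} (hd : d % 3 = 2) (hM : ¬ 3 ∣ M) :
    MapsTo signedConj (reps d M) (reps d M) := by
  rintro ⟨x, y⟩ ⟨h1, h2⟩
  have hxy := sub_emod_three_ne_zero hd hM h1
  simp only [signedConj] at *
  split_ifs with h
  · exact ⟨by rw [← h1]; ring, by simp only; omega⟩
  · exact ⟨by rw [← h1]; ring, by simp only; omega⟩

theorem signedConj_signedConj {d M : ℤ} {z : ℤ × ℤ} (hz : z ∈ reps d M) :
    signedConj (signedConj z) = z := by
  obtain ⟨x, y⟩ := z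
  have hxy := hz.2
  simp only [signedConj] at *
  split_ifs <;> refine Prod.ext ?_ ?_ <;> simp only at * <;> omega

theorem fixed_signedConj (d M : ℤ) :
    {z ∈ reps d M | signedConj z = z} =
      (fun x : ℤ => (x, (0 : ℤ))) '' {x | 1 * x ^ 2 = M ∧ x % 3 = 1} ∪
        (fun y : ℤ => ((0 : ℤ), y)) '' {y | d * y ^ 2 = M ∧ y % 3 = 1} := by
  ext ⟨x, y⟩
  simp only [reps, signedConj, mem_ofPred_eq, mem_union, mem_image, Prod.mk.injEq]
  constructor
  · rintro ⟨⟨h1, h2⟩, h3⟩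
    split_ifs at h3
    · obtain rfl : y = 0 := by simp only [Prod.mk.injEq] at h3; omega
      exact Or.inl ⟨x, ⟨by linarith, by omega⟩, rfl, rfl⟩
    · obtain rfl : x = 0 := by simp only [Prod.mk.injEq] at h3; omega
      exact Or.inr ⟨y, ⟨by linarith, by omega⟩, rfl, rfl⟩
  · rintro (⟨x, ⟨h1, h2⟩, rfl, rfl⟩ | ⟨y, ⟨h1, h2⟩, rfl, rfl⟩)
    · exact ⟨⟨by linarith, by omega⟩, by rw [if_pos (by omega), neg_zero]⟩
    · exact ⟨⟨by linarith, by omega⟩, by rw [if_neg (by omega), neg_zero]⟩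

theorem ncard_reps_of_not_three_dvd {d M : ℤ} (hd0 : 0 < d) (hd : d % 3 = 2) (hM : ¬ 3 ∣ M) :
    ((reps d M).ncard : ZMod 2) = squareIndicator 1 M + squareIndicator d M := by
  have hfin := (reps_finite hd0 M).subset (sep_subset _ fun z => signedConj z = z)
  rw [ncard_eq_ncard_fixedPoints (reps_finite hd0 M) (mapsTo_signedConj hd hM)
    fun z hz => signedConj_signedConj hz]
  rw [fixed_signedConj] at hfin ⊢
  rw [ncard_union_eq ?_ (hfin.subset subset_union_left) (hfin.subset subset_union_right),
    ncard_image_of_injective _ (Prod.mk_left_injective 0),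
    ncard_image_of_injective _ (Prod.mk_right_injective 0), Nat.cast_add,
    ncard_sq_emod_three one_ne_zero hM, ncard_sq_emod_three hd0.ne' hM]
  rw [disjoint_left]
  rintro _ ⟨x, ⟨-, hx⟩, rfl⟩ ⟨y, -, h⟩
  simp only [Prod.mk.injEq] at h
  omega

theorem emod_three_of_mem_reps {d M x y : ℤ} (hd : d % 3 = 2) (hM : 3 ∣ M)
    (h : (x, y) ∈ reps d M) : x % 3 = 2 ∧ y % 3 = 2 := by
  obtain ⟨rfl, hxy⟩ := h
  have hnorm := Int.emod_eq_zero_of_dvd hM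
  simp only at hxy hnorm
  rw [Int.add_emod, Int.mul_emod, hd] at hnorm
  rcases sq_emod_three x with hx | hx <;> rcases sq_emod_three y with hy | hy <;>
    rw [hx.2, hy.2] at hnorm <;> omega

theorem one_add_dvd_sub_of_mem_reps {d M x y : ℤ} (hd : d = 2 ∨ d = 5)
    (h : (x, y) ∈ reps d ((1 + d) * M)) : 1 + d ∣ x - y := by
  obtain ⟨hx, hy⟩ := emod_three_of_mem_reps (by omega)
    ((show (3 : ℤ) ∣ 1 + d by omega).mul_right M) h
  rcases hd with rfl | rfl
  · omega
  · have hnorm : x ^ 2 + 5 * y ^ 2 = (1 + 5) * M := h.1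
    rcases sq_emod_eight x with hx2 | hx2 <;> rcases sq_emod_eight y with hy2 | hy2 <;> omega

-- Multiplication by `-(1 + √(-d))`.
theorem ncard_reps_one_add_mul {d : ℤ} (hd : d = 2 ∨ d = 5) (M : ℤ) :
    (reps d ((1 + d) * M)).ncard = (reps d M).ncard := by
  have hd3 : d % 3 = 2 := by omega
  rw [← ncard_image_of_injective (f := fun z : ℤ × ℤ => (d * z.2 - z.1, -z.1 - z.2)) (reps d M)]
  · congr 1
    ext ⟨x, y⟩
    constructor
    · intro h
      obtain ⟨k, hk⟩ := one_add_dvd_sub_of_mem_reps hd h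
      obtain ⟨hx, hy⟩ := emod_three_of_mem_reps hd3
        ((show (3 : ℤ) ∣ 1 + d by omega).mul_right M) h
      obtain rfl : x = y + (1 + d) * k := by linarith
      refine ⟨(-y - k, k), ⟨mul_left_cancel₀ (show 1 + d ≠ 0 by omega) ?_, by simp only; omega⟩, ?_⟩
      · rw [← h.1]
        ring
      · simp only [Prod.mk.injEq]
        constructor <;> ring
    · rintro ⟨⟨x, y⟩, ⟨rfl, hxy⟩, h⟩
      obtain ⟨rfl, rfl⟩ := Prod.mk.inj h
      refine ⟨by ring, ?_⟩
      rcases hd with rfl | rfl <;> simp only at * <;> omega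
  · rintro ⟨x, y⟩ ⟨z, w⟩ h
    rcases hd with rfl | rfl <;> simp only [Prod.mk.injEq] at * <;> omega

theorem ncard_reps_five_four_mul (M : ℤ) : (reps 5 (4 * M)).ncard = (reps 5 M).ncard := by
  rw [← ncard_image_of_injective (f := fun z : ℤ × ℤ => (-2 * z.1, -2 * z.2)) (reps 5 M)]
  · congr 1
    ext ⟨x, y⟩
    constructor
    · rintro ⟨h1, h2⟩
      simp only at h1 h2
      have heven : x % 2 = 0 ∧ y % 2 = 0 := by
        rcases sq_emod_eight x with hx | hx <;> rcases sq_emod_eight y with hy | hy <;> omega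
      obtain ⟨k, rfl⟩ := Int.dvd_of_emod_eq_zero heven.1
      obtain ⟨l, rfl⟩ := Int.dvd_of_emod_eq_zero heven.2
      exact ⟨(-k, -l), ⟨by simp only; linarith, by simp only; omega⟩, by simp⟩
    · rintro ⟨⟨x, y⟩, ⟨rfl, hxy⟩, h⟩
      obtain ⟨rfl, rfl⟩ := Prod.mk.inj h
      exact ⟨by ring, by simp only at *; omega⟩
  · rintro ⟨x, y⟩ ⟨z, w⟩ h
    simp only [Prod.mk.injEq] at *
    omega

theorem ncard_reps_two_three_mul (M : ℤ) : (reps 2 (3 * M)).ncard = (reps 2 M).ncard :=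
  ncard_reps_one_add_mul (Or.inl rfl) M

-- `ℤ[√(-5)]` has no element of norm `3`, so the factor `3` is traded for a factor `2 = 6 * 2 / 4`.
theorem ncard_reps_five_three_mul (M : ℤ) :
    (reps 5 (3 * M)).ncard = (reps 5 (2 * M)).ncard := by
  rw [← ncard_reps_five_four_mul (3 * M), ← ncard_reps_one_add_mul (d := 5) (Or.inr rfl) (2 * M)]
  congr 2
  ring

theorem ncard_reps_nine_mul {d : ℤ} (hd : d = 2 ∨ d = 5) (M : ℤ) :
    (reps d (9 * M)).ncard = (reps d M).ncard := by
  rw [show 9 * M = 3 * (3 * M) by ring]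
  rcases hd with rfl | rfl
  · rw [ncard_reps_two_three_mul, ncard_reps_two_three_mul]
  · rw [ncard_reps_five_three_mul, ← ncard_reps_one_add_mul (Or.inr rfl) M]
    congr 2
    ring

theorem ncard_reps_three_mul_of_not_three_dvd {d M : ℤ} (hd : d = 2 ∨ d = 5) (hM : M % 4 = 3)
    (hM3 : ¬ 3 ∣ M) : ((reps d (3 * M)).ncard : ZMod 2) = 0 := by
  rcases hd with rfl | rfl
  · rw [ncard_reps_two_three_mul, ncard_reps_of_not_three_dvd (by norm_num) (by norm_num) hM3,
      squareIndicator_eq_zero, squareIndicator_eq_zero, add_zero] <;> intro x <;>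
      rcases sq_emod_eight x with hx | hx <;> omega
  · rw [ncard_reps_five_three_mul,
      ncard_reps_of_not_three_dvd (by norm_num) (by norm_num) (by omega),
      squareIndicator_eq_zero, squareIndicator_eq_zero, add_zero] <;> intro x <;>
      rcases sq_emod_eight x with hx | hx <;> omega

theorem ncard_reps_of_not_nine_dvd {d M : ℤ} (hd : d = 2 ∨ d = 5) (hM : M % 4 = 1)
    (hM9 : ¬ 9 ∣ M) :
    ((reps d M).ncard : ZMod 2) = squareIndicator 1 M + squareIndicator d M := by
  by_cases hM3 : 3 ∣ M
  · obtain ⟨K, rfl⟩ := hM3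
    have hK : ¬ 3 ∣ K := by omega
    rw [ncard_reps_three_mul_of_not_three_dvd hd (by omega) hK,
      squareIndicator_three_mul (by norm_num) hK, squareIndicator_three_mul (by omega) hK, add_zero]
  · exact ncard_reps_of_not_three_dvd (by omega) (by omega) hM3

theorem ncard_reps {d M : ℤ} (hd : d = 2 ∨ d = 5) (hM : M % 4 = 1) :
    ((reps d M).ncard : ZMod 2) = squareIndicator 1 M + squareIndicator d M := by
  obtain ⟨k, K, hK, rfl⟩ : ∃ k K, ¬ 9 ∣ K ∧ M = 9 ^ k * K := by
    have hfin : FiniteMultiplicity 9 M :=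
      Int.finiteMultiplicity_iff.mpr ⟨by norm_num, by rintro rfl; omega⟩
    obtain ⟨K, h, hK⟩ := hfin.exists_eq_pow_mul_and_not_dvd
    exact ⟨_, K, hK, h⟩
  induction k with
  | zero => simpa using ncard_reps_of_not_nine_dvd hd (by simpa using hM) hK
  | succ k ih =>
    rw [pow_succ', mul_assoc] at hM ⊢
    rw [ncard_reps_nine_mul hd, ih (by omega), squareIndicator_nine_mul (by norm_num),
      squareIndicator_nine_mul (by omega)]

end Reps

section ThetaReps

/-- The representations of `K` by `a * u ^ 2 + b * v ^ 2` that index the terms of the series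
`f a * f b`: by the pentagonal number theorem, each `u ≡ 1` modulo `6` gives the term
`± q ^ ((u ^ 2 - 1) / 24)` of `f 1`. -/
def thetaReps (a b K : ℤ) : Set (ℤ × ℤ) :=
  {z | a * z.1 ^ 2 + b * z.2 ^ 2 = K ∧ z.1 % 6 = 1 ∧ z.2 % 6 = 1}

theorem odd_of_mem_reps_one_add_mul {d M x y : ℤ} (hd : d = 2 ∨ d = 5) (hM : M % 4 = 1)
    (h : (x, y) ∈ reps d ((1 + d) * M)) : x % 2 = 1 ∧ y % 2 = 1 := by
  have hnorm : x ^ 2 + d * y ^ 2 = (1 + d) * M := h.1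
  rcases hd with rfl | rfl <;>
    rcases sq_emod_eight x with hx | hx <;> rcases sq_emod_eight y with hy | hy <;> omega

theorem ncard_thetaReps_one {d M : ℤ} (hd : d = 2 ∨ d = 5) (hM : M % 4 = 1) :
    (thetaReps 1 d ((1 + d) * M)).ncard = (reps d M).ncard := by
  rw [← ncard_reps_one_add_mul hd,
    ← ncard_image_of_injective (reps d ((1 + d) * M)) neg_injective]
  congr 1
  ext ⟨x, y⟩
  constructor
  · rintro ⟨h, hx, hy⟩
    simp only at h hx hy
    exact ⟨(-x, -y), ⟨by simp only; linarith, by simp only; omega⟩, by simp⟩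
  · rintro ⟨⟨x, y⟩, h, hxy⟩
    obtain ⟨rfl, rfl⟩ := Prod.mk.inj hxy
    obtain ⟨hx2, hy2⟩ := odd_of_mem_reps_one_add_mul hd hM h
    obtain ⟨hx3, hy3⟩ := emod_three_of_mem_reps (by omega)
      ((show (3 : ℤ) ∣ 1 + d by omega).mul_right M) h
    exact ⟨by rw [← h.1]; ring, by simp only; omega, by simp only; omega⟩

theorem ncard_thetaReps_two_five (K : ℤ) :
    (thetaReps 2 5 (5 * K)).ncard = (thetaReps 1 10 K).ncard := by
  rw [← ncard_image_of_injective (f := fun z : ℤ × ℤ => (-5 * z.2, z.1)) (thetaReps 1 10 K)]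
  · congr 1
    ext ⟨u, v⟩
    constructor
    · rintro ⟨h, hu, hv⟩
      simp only at h hu hv
      have h5 : 5 ∣ u := by
        have hdvd : 5 ∣ u ^ 2 := by omega
        exact Int.Prime.dvd_pow' (by norm_num) hdvd
      obtain ⟨w, rfl⟩ := h5
      exact ⟨(v, -w), ⟨by simp only; linarith, hv, by simp only; omega⟩, by simp⟩
    · rintro ⟨⟨x, y⟩, ⟨rfl, hx, hy⟩, h⟩
      obtain ⟨rfl, rfl⟩ := Prod.mk.inj h
      exact ⟨by ring, by simp only at *; omega, hx⟩
  · rintro ⟨x, y⟩ ⟨z, w⟩ h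
    simp only [Prod.mk.injEq] at *
    omega

/-- For a prime `m`, this says that the form `a * u ^ 2 + b * v ^ 2` has no nontrivial zero
modulo `m`. -/
def Anisotropic (a b m : ℤ) : Prop :=
  ∀ u v : ℤ, m ∣ a * u ^ 2 + b * v ^ 2 → m ∣ u ∧ m ∣ v

theorem Anisotropic.ncard_thetaReps_sq_mul {a b m : ℤ} (h : Anisotropic a b m) (hm : m % 6 = 1)
    (K : ℤ) : (thetaReps a b (m ^ 2 * K)).ncard = (thetaReps a b K).ncard := by
  have hm0 : m ≠ 0 := by rintro rfl; omega
  have hmod (x : ℤ) : m * x % 6 = x % 6 := by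
    rw [Int.mul_emod, hm, one_mul, Int.emod_emod_of_dvd _ dvd_rfl]
  rw [← ncard_image_of_injective (f := fun z : ℤ × ℤ => (m * z.1, m * z.2)) (thetaReps a b K)]
  · congr 1
    ext ⟨u, v⟩
    constructor
    · rintro ⟨huv, hu, hv⟩
      obtain ⟨⟨x, rfl⟩, ⟨y, rfl⟩⟩ := h u v ⟨m * K, by linear_combination huv⟩
      simp only [hmod] at huv hu hv
      exact ⟨(x, y), ⟨mul_left_cancel₀ (pow_ne_zero 2 hm0) (by linear_combination huv), hu, hv⟩,
        rfl⟩
    · rintro ⟨⟨x, y⟩, ⟨rfl, hx, hy⟩, hxy⟩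
      obtain ⟨rfl, rfl⟩ := Prod.mk.inj hxy
      exact ⟨by ring, by simp only [hmod, hx], by simp only [hmod, hy]⟩
  · rintro ⟨x, y⟩ ⟨z, w⟩ h
    simpa [hm0] using h

theorem Anisotropic.ncard_thetaReps_pow_mul {a b m : ℤ} (h : Anisotropic a b m) (hm : m % 6 = 1)
    (k : ℕ) (K : ℤ) : (thetaReps a b (m ^ (2 * k) * K)).ncard = (thetaReps a b K).ncard := by
  induction k with
  | zero => simp
  | succ k ih =>
    rw [← ih, ← h.ncard_thetaReps_sq_mul hm (m ^ (2 * k) * K)]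
    congr 2
    ring

theorem Anisotropic.thetaReps_mul_eq_empty {a b m K : ℤ} (h : Anisotropic a b m) (hm : m ≠ 0)
    (hK : ¬ m ∣ K) : thetaReps a b (m * K) = ∅ := by
  refine eq_empty_of_forall_notMem fun ⟨u, v⟩ ⟨huv, _⟩ => hK ?_
  obtain ⟨⟨x, rfl⟩, ⟨y, rfl⟩⟩ := h u v ⟨K, huv⟩
  exact ⟨a * x ^ 2 + b * y ^ 2, mul_left_cancel₀ hm (by linear_combination -huv)⟩

theorem anisotropic_of_legendreSym {p : ℕ} [Fact p.Prime] {a b : ℤ}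
    (h : legendreSym p (-(a * b)) = -1) : Anisotropic a b p := by
  intro u v huv
  obtain ⟨hau, hv⟩ := legendreSym.prime_dvd_of_eq_neg_one (a := -(a * b)) h (x := a * u) (y := v)
    ((huv.mul_left a).trans ⟨1, by ring⟩)
  refine ⟨((Nat.prime_iff_prime_int.mp Fact.out).dvd_or_dvd hau).resolve_left fun ha => ?_, hv⟩
  have hzero : legendreSym p (-(a * b)) = 0 := by
    rw [legendreSym.eq_zero_iff, ZMod.intCast_zmod_eq_zero_iff_dvd]
    exact (ha.mul_right b).neg_right
  omega

theorem mod_six_of_coprime {n : ℕ} (hn : n.Coprime 6) : n % 6 = 1 ∨ n % 6 = 5 := by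
  have h2 := Nat.prime_two.coprime_iff_not_dvd.mp (hn.symm.coprime_dvd_left (by norm_num))
  have h3 := Nat.prime_three.coprime_iff_not_dvd.mp (hn.symm.coprime_dvd_left (by norm_num))
  omega

theorem ncard_thetaReps_pow_mul {n : ℕ} {a b : ℤ} (h : Anisotropic a b n) (hn : n.Coprime 6)
    (k : ℕ) (K : ℤ) :
    (thetaReps a b ((n : ℤ) ^ (2 * k) * K)).ncard = (thetaReps a b K).ncard := by
  rcases mod_six_of_coprime hn with h1 | h5
  · exact h.ncard_thetaReps_pow_mul (by omega) k K
  · have hneg : Anisotropic a b (-n) := fun u v huv => by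
      simpa only [neg_dvd] using h u v (neg_dvd.mp huv)
    rw [← (even_two_mul k).neg_pow, hneg.ncard_thetaReps_pow_mul (by omega)]

theorem sq_mod_twentyFour {n : ℕ} (hn : n.Coprime 6) : n ^ 2 % 24 = 1 := by
  have hn6 := mod_six_of_coprime hn
  have h3 := sq_emod_three n
  have h8 := sq_emod_eight n
  zify
  omega

theorem pow_two_mul_mod_twentyFour {n : ℕ} (hn : n.Coprime 6) (k : ℕ) :
    n ^ (2 * k) % 24 = 1 := by
  rw [pow_mul, Nat.pow_mod, sq_mod_twentyFour hn, one_pow, Nat.one_mod]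

end ThetaReps

section Series

/-- The reduction modulo `2` of the Euler product `f k`. -/
noncomputable def fModTwo (k : ℕ) : PowerSeries (ZMod 2) :=
  PowerSeries.map (Int.castRingHom (ZMod 2)) (f k)

theorem continuous_powerSeries_map {R S : Type*} [Semiring R] [Semiring S] [TopologicalSpace R]
    [TopologicalSpace S] {φ : R →+* S} (hφ : Continuous φ) : Continuous (PowerSeries.map φ) := by
  refine continuous_iff_continuousAt.mpr fun A => ?_
  rw [ContinuousAt, WithPiTopology.tendsto_iff_coeff_tendsto]
  simp only [coeff_map]
  exact fun d => (hφ.comp (WithPiTopology.continuous_coeff R d)).continuousAt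

theorem continuous_expand {R : Type*} [CommRing R] [TopologicalSpace R] {k : ℕ} (hk : k ≠ 0) :
    Continuous (expand (R := R) k hk) := by
  refine continuous_iff_continuousAt.mpr fun A => ?_
  rw [ContinuousAt, WithPiTopology.tendsto_iff_coeff_tendsto]
  intro d
  simp only [coeff_expand]
  split_ifs
  · exact (WithPiTopology.continuous_coeff R _).continuousAt
  · exact tendsto_const_nhds

theorem hasProd_fModTwo {k : ℕ} (hk : k ≠ 0) :
    HasProd (fun m : ℕ => (1 - X ^ (k * (m + 1)) : PowerSeries (ZMod 2))) (fModTwo k) := by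
  have h := (multipliable_f k (Nat.one_le_iff_ne_zero.mpr hk)).hasProd.map
    (PowerSeries.map (Int.castRingHom (ZMod 2)))
    (continuous_powerSeries_map continuous_of_discreteTopology)
  simpa only [fModTwo, f, Function.comp_def, map_sub, map_one, map_pow, map_X] using h

theorem fModTwo_mul {k l : ℕ} (hk : k ≠ 0) (hl : l ≠ 0) :
    fModTwo (k * l) = expand k hk (fModTwo l) := by
  have h := (hasProd_fModTwo hl).map (expand k hk) (continuous_expand hk)
  refine (hasProd_fModTwo (mul_ne_zero hk hl)).unique ?_
  simpa only [Function.comp_def, map_sub, map_one, map_pow, expand_X, ← pow_mul, mul_assoc] using h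

theorem fModTwo_one : fModTwo 1 = pentagonalSeries (ZMod 2) := by
  refine (hasProd_fModTwo one_ne_zero).unique ?_
  simpa only [one_mul] using WithPiTopology.hasProd_one_sub_X_pow (ZMod 2)

theorem expand_two_eq_sq (A : PowerSeries (ZMod 2)) : expand 2 two_ne_zero A = A ^ 2 := by
  have h := MvPowerSeries.map_frobenius_expand (R := ZMod 2) 2 two_ne_zero (f := A)
  rwa [ZMod.frobenius_zmod, MvPowerSeries.map_id] at h

theorem fModTwo_two_mul {k : ℕ} (hk : k ≠ 0) : fModTwo (2 * k) = fModTwo k ^ 2 := by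
  rw [fModTwo_mul two_ne_zero hk, expand_two_eq_sq]

theorem fModTwo_two : fModTwo 2 = fModTwo 1 ^ 2 := by
  rw [← fModTwo_two_mul one_ne_zero, mul_one]

theorem coeff_two_mul_sq_add_X_mul_sq (A B : PowerSeries (ZMod 2)) (n : ℕ) :
    coeff (2 * n) (A ^ 2 + X * B ^ 2) = coeff n A := by
  have hX : coeff (2 * n) (X * B ^ 2) = 0 := by
    cases n with
    | zero => exact coeff_zero_X_mul _
    | succ n =>
      rw [show 2 * (n + 1) = (2 * n + 1) + 1 by ring, coeff_succ_X_mul, ← expand_two_eq_sq,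
        coeff_expand_of_not_dvd _ _ _ (by omega)]
  rw [map_add, hX, add_zero, ← expand_two_eq_sq, coeff_expand_mul]

theorem coeff_two_mul_add_one_sq_add_X_mul_sq (A B : PowerSeries (ZMod 2)) (n : ℕ) :
    coeff (2 * n + 1) (A ^ 2 + X * B ^ 2) = coeff n B := by
  rw [map_add, coeff_succ_X_mul, ← expand_two_eq_sq, ← expand_two_eq_sq, coeff_expand_mul,
    coeff_expand_of_not_dvd _ _ _ (by omega), zero_add]

open Classical in
theorem coeff_fModTwo {k : ℕ} (hk : k ≠ 0) (n : ℕ) :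
    coeff n (fModTwo k) = if ∃ i, k * pentagonal i = n then 1 else 0 := by
  rw [← mul_one k, fModTwo_mul hk one_ne_zero, mul_one, fModTwo_one]
  split_ifs with h
  · obtain ⟨i, rfl⟩ := h
    rw [coeff_expand_mul, coeff_pentagonalSeries_pentagonal]
    rcases Int.units_eq_one_or (Int.negOnePow i) with h | h <;> rw [h] <;> decide
  · rw [coeff_expand]
    split_ifs with hd
    · obtain ⟨m, rfl⟩ := hd
      rw [Nat.mul_div_cancel_left _ (Nat.pos_of_ne_zero hk), coeff_pentagonalSeries_eq_zero]
      rintro ⟨i, rfl⟩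
      exact h ⟨i, rfl⟩
    · rfl

theorem fModTwo_ne_zero {k : ℕ} (hk : k ≠ 0) : fModTwo k ≠ 0 := by
  classical
  intro h
  have h0 := coeff_fModTwo hk 0
  rw [if_pos ⟨0, by rw [pentagonal_def]; rfl⟩, h, map_zero] at h0
  exact zero_ne_one h0

theorem coeff_fModTwo_mul_fModTwo_eq_ncard_pentagonal {a b : ℕ} (ha : a ≠ 0) (hb : b ≠ 0) (N : ℕ) :
    coeff N (fModTwo a * fModTwo b) =
      ({z : ℤ × ℤ | a * pentagonal z.1 + b * pentagonal z.2 = N}.ncard : ZMod 2) := by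
  classical
  let g : ℤ × ℤ → ℕ × ℕ := fun z => (a * pentagonal z.1, b * pentagonal z.2)
  have hg : Function.Injective g := by
    rintro ⟨x, y⟩ ⟨z, w⟩ h
    simpa [g, ha, hb] using h
  have himage : g '' {z : ℤ × ℤ | a * pentagonal z.1 + b * pentagonal z.2 = N} =
      (((Finset.HasAntidiagonal.antidiagonal N).filter fun z =>
        (∃ i, a * pentagonal i = z.1) ∧ ∃ j, b * pentagonal j = z.2 : Finset (ℕ × ℕ)) :
        Set (ℕ × ℕ)) := by
    ext ⟨m, n⟩
    simp only [g, Finset.coe_filter, Finset.HasAntidiagonal.mem_antidiagonal, mem_ofPred_eq,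
      mem_image, Prod.exists, Prod.mk.injEq]
    constructor
    · rintro ⟨i, j, h, rfl, rfl⟩
      exact ⟨h, ⟨i, rfl⟩, ⟨j, rfl⟩⟩
    · rintro ⟨h, ⟨i, rfl⟩, ⟨j, rfl⟩⟩
      exact ⟨i, j, h, rfl, rfl⟩
  rw [← ncard_image_of_injective _ hg, himage, ncard_coe_finset, coeff_mul, Finset.card_filter,
    Nat.cast_sum]
  refine Finset.sum_congr rfl fun z _ => ?_
  rw [coeff_fModTwo ha, coeff_fModTwo hb, ite_and, ite_mul, one_mul, zero_mul]
  push_cast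
  rfl

theorem twentyFour_mul_pentagonal_add_one (i : ℤ) :
    24 * (pentagonal i : ℤ) + 1 = (1 - 6 * i) ^ 2 := by
  linear_combination 12 * two_mul_natCast_pentagonal i

theorem coeff_fModTwo_mul_fModTwo {a b : ℕ} (ha : a ≠ 0) (hb : b ≠ 0) (N : ℕ) :
    coeff N (fModTwo a * fModTwo b) = ((thetaReps a b (24 * N + a + b)).ncard : ZMod 2) := by
  have himage : (fun z : ℤ × ℤ => (1 - 6 * z.1, 1 - 6 * z.2)) ''
      {z | a * pentagonal z.1 + b * pentagonal z.2 = N} = thetaReps a b (24 * N + a + b) := by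
    ext ⟨u, v⟩
    constructor
    · rintro ⟨⟨i, j⟩, rfl, h⟩
      obtain ⟨rfl, rfl⟩ := Prod.mk.inj h
      refine ⟨?_, by simp only; omega, by simp only; omega⟩
      rw [← twentyFour_mul_pentagonal_add_one, ← twentyFour_mul_pentagonal_add_one]
      push_cast
      ring
    · rintro ⟨h, hu, hv⟩
      obtain ⟨i, rfl⟩ : ∃ i, u = 1 - 6 * i := ⟨(1 - u) / 6, by simp only at hu; omega⟩
      obtain ⟨j, rfl⟩ : ∃ j, v = 1 - 6 * j := ⟨(1 - v) / 6, by simp only at hv; omega⟩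
      rw [← twentyFour_mul_pentagonal_add_one, ← twentyFour_mul_pentagonal_add_one] at h
      refine ⟨(i, j), ?_, rfl⟩
      rw [mem_ofPred_eq]
      zify
      linarith
  rw [coeff_fModTwo_mul_fModTwo_eq_ncard_pentagonal ha hb, ← himage, ncard_image_of_injective]
  rintro ⟨x, y⟩ ⟨z, w⟩ h
  simpa using h

theorem coeff_fModTwo_one_pow_three (n : ℕ) :
    coeff n (fModTwo 1 ^ 3) = squareIndicator 1 (8 * n + 1) := by
  have hindicator : squareIndicator 2 (8 * n + 1) = 0 :=
    squareIndicator_eq_zero fun x hx => by omega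
  rw [pow_succ', ← fModTwo_two, coeff_fModTwo_mul_fModTwo one_ne_zero (by norm_num),
    ← add_zero (squareIndicator 1 _), ← hindicator, ← ncard_reps (Or.inl rfl) (by omega),
    ← ncard_thetaReps_one (Or.inl rfl) (by omega)]
  congr 3
  push_cast
  ring

theorem coeff_fModTwo_one_pow_six (n : ℕ) :
    coeff n (fModTwo 1 ^ 6) = squareIndicator 1 (4 * n + 1) := by
  rw [show fModTwo 1 ^ 6 = (fModTwo 1 ^ 3) ^ 2 by ring, ← expand_two_eq_sq]
  obtain ⟨m, rfl | rfl⟩ := n.even_or_odd'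
  · rw [coeff_expand_mul, coeff_fModTwo_one_pow_three]
    congr 1
    push_cast
    ring
  · rw [coeff_expand_of_not_dvd _ _ _ (by omega), squareIndicator_eq_zero]
    intro x hx
    rcases sq_emod_eight x with h | h <;> omega

theorem coeff_fModTwo_five_pow_six (n : ℕ) :
    coeff n (fModTwo 5 ^ 6) = squareIndicator 5 (4 * n + 5) := by
  rw [show fModTwo 5 ^ 6 = expand 5 (by norm_num) (fModTwo 1 ^ 6) by
    rw [map_pow, ← fModTwo_mul _ one_ne_zero, mul_one]]
  by_cases h5 : 5 ∣ n
  · obtain ⟨m, rfl⟩ := h5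
    rw [coeff_expand_mul, coeff_fModTwo_one_pow_six]
    refine squareIndicator_congr (exists_congr fun x => ?_)
    push_cast
    omega
  · rw [coeff_expand_of_not_dvd _ _ _ h5, squareIndicator_eq_zero]
    intro x hx
    omega

theorem fModTwo_one_mul_fModTwo_five :
    fModTwo 1 * fModTwo 5 = fModTwo 1 ^ 6 + X * fModTwo 5 ^ 6 := by
  ext N
  have hX : coeff N (X * fModTwo 5 ^ 6) = squareIndicator 5 (4 * N + 1) := by
    cases N with
    | zero =>
      rw [coeff_zero_X_mul, squareIndicator_eq_zero]
      intro x hx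
      push_cast at hx
      omega
    | succ n =>
      rw [coeff_succ_X_mul, coeff_fModTwo_five_pow_six]
      rfl
  rw [map_add, hX, coeff_fModTwo_one_pow_six, ← ncard_reps (Or.inr rfl) (by omega),
    ← ncard_thetaReps_one (Or.inr rfl) (by omega),
    coeff_fModTwo_mul_fModTwo one_ne_zero (by norm_num)]
  congr 3
  push_cast
  ring

end Series

section GeneratingFunction

theorem prod_toFinsupp_eq_ite {n : ℕ} (P : ℕ → Prop) [DecidablePred P] (π : n.Partition)
    (R : Type*) [CommSemiring R] :
    (Multiset.toFinsupp π.parts).prod (fun i c => if c ≤ 1 ∧ P i then (1 : R) else 0) =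
      if π.parts.Nodup ∧ ∀ i ∈ π.parts, P i then 1 else 0 := by
  rw [Finsupp.prod, Finset.prod_boole]
  refine if_congr ?_ rfl rfl
  simp only [Multiset.toFinsupp_support, Multiset.mem_toFinset, Multiset.toFinsupp_apply,
    Multiset.nodup_iff_count_le_one]
  refine ⟨fun h => ⟨fun i => ?_, fun i hi => (h i hi).2⟩, fun h i hi => ⟨h.1 i, h.2 i hi⟩⟩
  by_cases hi : i ∈ π.parts
  · exact (h i hi).1
  · exact (Multiset.count_eq_zero_of_notMem hi).trans_le zero_le_one

theorem hasProd_distinct_partitions (R : Type*) [CommSemiring R] [TopologicalSpace R] [T2Space R]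
    (P : ℕ → Prop) [DecidablePred P] :
    HasProd (fun i : ℕ => if P (i + 1) then (1 + X ^ (i + 1) : PowerSeries R) else 1)
      (PowerSeries.mk fun n => ((Finset.univ.filter fun π : n.Partition =>
        π.parts.Nodup ∧ ∀ i ∈ π.parts, P i).card : R)) := by
  convert! Nat.Partition.hasProd_genFun
    (fun i c => if c ≤ 1 ∧ P i then (1 : R) else 0) using 1
  · ext1 i
    rw [tsum_eq_single 0 fun j hj => by rw [if_neg (by omega), zero_smul]]
    split_ifs <;> simp_all
  · ext n
    rw [coeff_mk, Nat.Partition.coeff_genFun, Finset.card_filter, Nat.cast_sum]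
    simp only [prod_toFinsupp_eq_ite, Nat.cast_ite, Nat.cast_one, Nat.cast_zero]

/-- The generating function of `a r s` modulo `2`. -/
noncomputable def aModTwo (r s : ℕ) : PowerSeries (ZMod 2) :=
  PowerSeries.mk fun n => (a r s n : ZMod 2)

theorem hasProd_aModTwo (r s : ℕ) :
    HasProd (fun i : ℕ => if ¬ r ∣ i + 1 ∧ ¬ s ∣ i + 1 then
      (1 - X ^ (i + 1) : PowerSeries (ZMod 2)) else 1) (aModTwo r s) := by
  have hsub (i : ℕ) : (1 - X ^ (i + 1) : PowerSeries (ZMod 2)) = 1 + X ^ (i + 1) := by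
    ext n
    rw [map_sub, map_add, CharTwo.sub_eq_add]
  simp only [hsub]
  exact hasProd_distinct_partitions (ZMod 2) fun i => ¬ r ∣ i ∧ ¬ s ∣ i

theorem hasProd_fModTwo_ite {k : ℕ} (hk : k ≠ 0) :
    HasProd (fun i : ℕ => if k ∣ i + 1 then (1 - X ^ (i + 1) : PowerSeries (ZMod 2)) else 1)
      (fModTwo k) := by
  have hpos (m : ℕ) : 1 ≤ k * (m + 1) := Nat.mul_pos (Nat.pos_of_ne_zero hk) m.succ_pos
  have hinj : Function.Injective fun m : ℕ => k * (m + 1) - 1 := fun m n h => by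
    have hmul : k * (m + 1) = k * (n + 1) := by
      rw [← Nat.sub_add_cancel (hpos m), ← Nat.sub_add_cancel (hpos n)]
      exact congrArg (· + 1) h
    exact Nat.succ_injective (mul_left_cancel₀ hk hmul)
  rw [← hinj.hasProd_iff]
  · convert hasProd_fModTwo hk using 1
    ext1 m
    rw [Function.comp_apply, Nat.sub_add_cancel (hpos m), if_pos (dvd_mul_right k _)]
  · intro i hi
    refine if_neg ?_
    rintro ⟨m, hm⟩
    obtain ⟨m, rfl⟩ : ∃ l, m = l + 1 := Nat.exists_eq_succ_of_ne_zero fun h => by simp [h] at hm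
    exact hi ⟨m, by simp only; omega⟩

theorem aModTwo_mul_fModTwo_mul_fModTwo {r s : ℕ} (hr : r ≠ 0) (hs : s ≠ 0)
    (hrs : r.Coprime s) :
    aModTwo r s * fModTwo r * fModTwo s = fModTwo 1 * fModTwo (r * s) := by
  refine (((hasProd_aModTwo r s).mul (hasProd_fModTwo_ite hr)).mul
    (hasProd_fModTwo_ite hs)).unique ?_
  convert (hasProd_fModTwo_ite one_ne_zero).mul (hasProd_fModTwo_ite (mul_ne_zero hr hs)) using 1
  ext1 i
  have hdvd : r * s ∣ i + 1 ↔ r ∣ i + 1 ∧ s ∣ i + 1 :=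
    ⟨fun h => ⟨dvd_of_mul_right_dvd h, dvd_of_mul_left_dvd h⟩,
      fun h => hrs.mul_dvd_of_dvd_of_dvd h.1 h.2⟩
  by_cases hri : r ∣ i + 1 <;> by_cases hsi : s ∣ i + 1 <;> simp [hdvd, hri, hsi]

theorem aModTwo_two_five_mul_fModTwo_one : aModTwo 2 5 * fModTwo 1 = fModTwo 5 := by
  have h := aModTwo_mul_fModTwo_mul_fModTwo two_ne_zero (by norm_num : 5 ≠ 0) (by norm_num)
  rw [fModTwo_two, fModTwo_two_mul (by norm_num)] at h
  refine mul_right_cancel₀ (mul_ne_zero (fModTwo_ne_zero one_ne_zero)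
    (fModTwo_ne_zero (by norm_num : 5 ≠ 0))) ?_
  linear_combination h

theorem aModTwo_two_five_dissection :
    aModTwo 2 5 = (fModTwo 1 ^ 2) ^ 2 + X * (aModTwo 2 5 * fModTwo 5 ^ 2) ^ 2 := by
  refine mul_right_cancel₀ (pow_ne_zero 2 (fModTwo_ne_zero one_ne_zero)) ?_
  linear_combination fModTwo_one_mul_fModTwo_five + fModTwo 1 * aModTwo_two_five_mul_fModTwo_one
    - X * fModTwo 5 ^ 4 * (aModTwo 2 5 * fModTwo 1 + fModTwo 5) * aModTwo_two_five_mul_fModTwo_one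

theorem a_four_mul_add_one (n : ℕ) :
    (a 2 5 (4 * n + 1) : ZMod 2) = coeff n (fModTwo 2 * fModTwo 5) := by
  have hdissect : aModTwo 2 5 * fModTwo 5 ^ 2 =
      (fModTwo 1 ^ 2 * fModTwo 5) ^ 2 + X * (aModTwo 2 5 * fModTwo 5 ^ 3) ^ 2 := by
    linear_combination fModTwo 5 ^ 2 * aModTwo_two_five_dissection
  calc (a 2 5 (4 * n + 1) : ZMod 2)
      = coeff (2 * (2 * n) + 1) (aModTwo 2 5) := by rw [aModTwo, coeff_mk, ← mul_assoc]; rfl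
    _ = coeff (2 * n) (aModTwo 2 5 * fModTwo 5 ^ 2) := by
        conv_lhs => rw [aModTwo_two_five_dissection, coeff_two_mul_add_one_sq_add_X_mul_sq]
    _ = coeff n (fModTwo 2 * fModTwo 5) := by
        rw [hdissect, coeff_two_mul_sq_add_X_mul_sq, ← fModTwo_two]

theorem a_eq_ncard_thetaReps {m : ℕ} (hm : m % 4 = 1) :
    (a 2 5 m : ZMod 2) = (thetaReps 2 5 (6 * m + 1)).ncard := by
  obtain ⟨n, rfl⟩ : ∃ n, m = 4 * n + 1 := ⟨m / 4, by omega⟩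
  rw [a_four_mul_add_one, coeff_fModTwo_mul_fModTwo two_ne_zero (by norm_num)]
  congr 3
  push_cast
  ring

theorem a_twenty_mul_add_nine (n : ℕ) :
    (a 2 5 (20 * n + 9) : ZMod 2) = coeff n (fModTwo 1 * fModTwo 10) := by
  rw [a_eq_ncard_thetaReps (by omega), coeff_fModTwo_mul_fModTwo one_ne_zero (by norm_num),
    Nat.cast_one, Nat.cast_ofNat, ← ncard_thetaReps_two_five]
  congr 3
  push_cast
  ring

end GeneratingFunction

theorem seriesModEq_two_iff {u : ℕ → ℕ} {k l : ℕ} :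
    SeriesModEq 2 (PowerSeries.mk fun n => (u n : ℤ)) (f k * f l) ↔
      ∀ n, (u n : ZMod 2) = coeff n (fModTwo k * fModTwo l) := by
  refine forall_congr' fun n => ?_
  rw [fModTwo, fModTwo, ← map_mul, coeff_map, coeff_mk, ← Int.cast_natCast (u n)]
  exact (ZMod.intCast_eq_intCast_iff _ _ 2).symm

theorem a_eq_of_eq_pow_mul {q k m m' : ℕ} (h : Anisotropic 2 5 q) (hq : q.Coprime 6)
    (hm : m % 4 = 1) (hmm' : 6 * m' + 1 = q ^ (2 * k) * (6 * m + 1)) :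
    (a 2 5 m' : ZMod 2) = a 2 5 m := by
  have hm' : (6 * m' + 1) % 24 = (6 * m + 1) % 24 := by
    rw [hmm', Nat.mul_mod, pow_two_mul_mod_twentyFour hq, one_mul, Nat.mod_mod]
  rw [a_eq_ncard_thetaReps hm, a_eq_ncard_thetaReps (by omega),
    ← ncard_thetaReps_pow_mul h hq k (6 * m + 1)]
  congr 3
  exact_mod_cast hmm'

theorem a_eq_zero_of_eq_pow_mul {q k m K : ℕ} (h : Anisotropic 2 5 q) (hq : q.Coprime 6)
    (hm : m % 4 = 1) (hmK : 6 * m + 1 = q ^ (2 * k + 1) * K) (hK : ¬ q ∣ K) :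
    (a 2 5 m : ZMod 2) = 0 := by
  have hq0 : (q : ℤ) ≠ 0 := by
    rintro hq0
    simp [Int.natCast_eq_zero.mp hq0] at hq
  have hmK' : (6 * m + 1 : ℤ) = q ^ (2 * k) * (q * K) := by
    rw [← mul_assoc, ← pow_succ]
    exact_mod_cast hmK
  rw [a_eq_ncard_thetaReps hm, hmK', ncard_thetaReps_pow_mul h hq,
    h.thetaReps_mul_eq_empty hq0 (mod_cast hK), ncard_empty, Nat.cast_zero]

theorem six_mul_add_one_of_mod_twentyFour (A : ℕ) {C : ℕ} (hC : C % 24 = 7) :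
    (4 * A + (C - 1) / 6) % 4 = 1 ∧ 6 * (4 * A + (C - 1) / 6) + 1 = 24 * A + C := by
  omega

theorem mul_pow_two_mul_mod_twentyFour {q c : ℕ} (hq : q.Coprime 6) (hc : c % 24 = 7) (k : ℕ) :
    c * q ^ (2 * k) % 24 = 7 := by
  rw [Nat.mul_mod, hc, pow_two_mul_mod_twentyFour hq]

theorem a_self_similar {q c : ℕ} (h : Anisotropic 2 5 q) (hq : q.Coprime 6) (hc : c % 24 = 7)
    (d k n : ℕ) :
    (a 2 5 (4 * d * q ^ (2 * k) * n + (c * q ^ (2 * k) - 1) / 6) : ZMod 2) =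
      a 2 5 (4 * d * n + (c - 1) / 6) := by
  obtain ⟨hm, hm6⟩ := six_mul_add_one_of_mod_twentyFour (d * n) hc
  obtain ⟨-, hm'6⟩ := six_mul_add_one_of_mod_twentyFour (d * q ^ (2 * k) * n)
    (mul_pow_two_mul_mod_twentyFour hq hc k)
  simp only [mul_assoc] at *
  refine a_eq_of_eq_pow_mul (k := k) h hq hm ?_
  rw [hm6, hm'6]
  ring

theorem a_modEq_zero {q c d j : ℕ} (h : Anisotropic 2 5 q) (hq : q.Coprime (24 * d))
    (hc : c % 24 = 7) (hj : ¬ q ∣ j) (k n : ℕ) :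
    a 2 5 (4 * d * q ^ (2 * k + 1) * (q * n + j) + (c * q ^ (2 * k + 2) - 1) / 6) ≡ 0 [MOD 2] := by
  have hq6 : q.Coprime 6 := hq.coprime_dvd_right ((by norm_num : 6 ∣ 24).mul_right d)
  obtain ⟨hm, hm6⟩ := six_mul_add_one_of_mod_twentyFour (d * q ^ (2 * k + 1) * (q * n + j))
    (mul_pow_two_mul_mod_twentyFour hq6 hc (k + 1))
  simp only [mul_assoc, mul_add_one] at *
  refine (ZMod.natCast_eq_natCast_iff _ _ 2).mp ?_
  rw [Nat.cast_zero]
  refine a_eq_zero_of_eq_pow_mul (k := k) (K := 24 * d * j + q * (24 * d * n + c)) h hq6 hm ?_ ?_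
  · rw [hm6]
    ring
  · rw [← Nat.dvd_add_iff_left (dvd_mul_right q _)]
    exact fun hdvd => hj (Nat.Coprime.dvd_of_dvd_mul_left hq hdvd)

end RegularPartitions

open RegularPartitions

theorem theorem1p2 (p : ℕ) [Fact p.Prime] (hp : 5 < p) (hleg : legendreSym p (-10) = -1)
    (γ : ℕ) :
    RegularPartitions.SeriesModEq 2
      (PowerSeries.mk fun n : ℕ =>
        (RegularPartitions.a 2 5 (4 * p ^ (2 * γ) * n + (7 * p ^ (2 * γ) - 1) / 6) : ℤ))
      (RegularPartitions.f 2 * RegularPartitions.f 5) ∧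
    (∀ n j : ℕ, 1 ≤ j → j ≤ p - 1 →
      RegularPartitions.a 2 5
        (4 * p ^ (2 * γ + 1) * (p * n + j) + (7 * p ^ (2 * γ + 2) - 1) / 6) ≡ 0 [MOD 2]) ∧
    RegularPartitions.SeriesModEq 2
      (PowerSeries.mk fun n : ℕ =>
        (RegularPartitions.a 2 5 (20 * p ^ (2 * γ) * n + (55 * p ^ (2 * γ) - 1) / 6) : ℤ))
      (RegularPartitions.f 1 * RegularPartitions.f 10) ∧
    (∀ n j : ℕ, 1 ≤ j → j ≤ p - 1 →
      RegularPartitions.a 2 5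
        (20 * p ^ (2 * γ + 1) * (p * n + j) + (55 * p ^ (2 * γ + 2) - 1) / 6) ≡ 0 [MOD 2]) := by
  have hform : Anisotropic 2 5 p := anisotropic_of_legendreSym hleg
  have hp120 : p.Coprime 120 := (Nat.Prime.coprime_iff_not_dvd Fact.out).mpr fun h =>
    hp.not_ge ((Nat.Prime.dvd_factorial Fact.out (n := 5)).mp h)
  have hp24 : p.Coprime 24 := hp120.coprime_dvd_right (by norm_num)
  have hp6 : p.Coprime 6 := hp120.coprime_dvd_right (by norm_num)
  have hj (j : ℕ) (h1 : 1 ≤ j) (h2 : j ≤ p - 1) : ¬ p ∣ j :=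
    Nat.not_dvd_of_pos_of_lt h1 (by omega)
  refine ⟨seriesModEq_two_iff.mpr fun n => ?_,
    fun n j h1 h2 => a_modEq_zero (d := 1) hform hp24 (by norm_num) (hj j h1 h2) γ n,
    seriesModEq_two_iff.mpr fun n => ?_,
    fun n j h1 h2 => a_modEq_zero (d := 5) hform hp120 (by norm_num) (hj j h1 h2) γ n⟩
  · exact (a_self_similar hform hp6 (by norm_num) 1 γ n).trans (a_four_mul_add_one n)
  · exact (a_self_similar hform hp6 (by norm_num) 5 γ n).trans (a_twenty_mul_add_nine n)
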